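/- Let $T>0$, $\theta>0$, $\sigma>0$, $\sigma_0\ge 0$ with $\theta T\le \frac43$, and let $X=(X_t)_{t\in[0,T]}$ be the centered Ornstein–Uhlenbeck process $$dX_t=-\theta X_t\,dt+\sigma\,dW_t,$$ where $W$ is a standard Brownian motion and $X_0\sim\mathcal N(0,\sigma_0^2)$ is independent of $W$. The variables $X_t$ are square integrable; write $\Gamma^X(s,t)=\mathbb E[X_sX_t]$, $H=\overline{\operatorname{span}\{X_t : t\in[0,T]\}}^{L^2(\mathbb P)}$, and let $$K_X=\{t\mapsto \mathbb E[ZX_t] : Z\in H\},\qquad \langle k_1,k_2\rangle_X=\mathbb E[Z_1Z_2]\ \text{ if }\ k_i=\mathbb E[Z_iX_\cdot],$$ be its Cameron–Martin space. Let $\mathcal E([0,T])$ be the space of piecewise constant functions on $[0,T]$ (the linear span of indicators of subintervals of $[0,T]$), let $J:\mathcal E([0,T])\to K_X$ be the linear map with $J(\mathbf 1_{|s,t|})=\Gamma^X(t,\cdot)-\Gamma^X(s,\cdot)$ for $s\le t$, where $|s,t|$ is any of the four intervals with end points $s$ and $t$, and put $\langle f,g\rangle_J=\langle Jf,Jg\rangle_X$,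 $\|f\|_J=\langle f,f\rangle_J^{1/2}$. Let $F$ (the domain of the Wiener integral with respect to $X$) be the completion, for $\langle\cdot,\cdot\rangle_J$, of the quotient of $\mathcal E([0,T])$ by the relation $f\sim g\Leftrightarrow\|f-g\|_J=0$. Then there are constants $c,C>0$ such that, for every $f\in\mathcal E([0,T])$, $$c\,\|f\|_2\le\|f\|_J\le C\,\|f\|_2,$$ where $\|f\|_2$ is the norm of $L^2([0,T],dt)$. Consequently $F=L^2([0,T])$, in the sense that there is a linear homeomorphism of $F$ onto $L^2([0,T],dt)$ which sends the element of $F$ represented by a step function $f$ to the class of $f$ in $L^2([0,T],dt)$. -/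

import Mathlib

open MeasureTheory ProbabilityTheory Set Filter Topology
open scoped NNReal ENNReal

namespace WienerOU

noncomputable section

/-! ### Step functions on `[0,T]` -/

/-- `S` is one of the four intervals with end points `a` and `b`. -/
def IsIntervalBetween (S : Set ℝ) (a b : ℝ) : Prop :=
  S = Icc a b ∨ S = Ioo a b ∨ S = Ioc a b ∨ S = Ico a b

/-- The space of piecewise constant functions on `[0,T]`: the linear span of the indicators of
intervals with end points in `[0,T]`. Functions on `[0,T]` are extended by zero to the line. -/
def stepFunctions (T : ℝ) : Submodule ℝ (ℝ → ℝ) :=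
  Submodule.span ℝ {f | ∃ s t : Icc (0 : ℝ) T, s ≤ t ∧ ∃ S : Set ℝ,
    IsIntervalBetween S s t ∧ f = S.indicator (fun _ => (1 : ℝ))}

/-- The `L²([0,T])`-norm of a step function. -/
def l2Norm {T : ℝ} (f : stepFunctions T) : ℝ := √(∫ t in Icc 0 T, (f : ℝ → ℝ) t ^ 2)

/-- An interval indicator belongs to the space of step functions. -/
def intervalStep {T : ℝ} (s t : Icc (0 : ℝ) T) (hst : s ≤ t) (S : Set ℝ)
    (hS : IsIntervalBetween S s t) : stepFunctions T :=
  ⟨S.indicator (fun _ => (1 : ℝ)), Submodule.subset_span ⟨s, t, hst, S, hS, rfl⟩⟩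

theorem indicator_limits {a b : ℝ} (_hab : a < b) {S : Set ℝ} (hS : IsIntervalBetween S a b)
    (x : ℝ) :
    Tendsto (S.indicator (fun _ => (1 : ℝ))) (𝓝[<] x) (𝓝 (if a < x ∧ x ≤ b then 1 else 0)) ∧
    Tendsto (S.indicator (fun _ => (1 : ℝ))) (𝓝[>] x) (𝓝 (if a ≤ x ∧ x < b then 1 else 0)) := by
  have hin : Ioo a b ⊆ S := by
    rcases hS with rfl | rfl | rfl | rfl
    · exact Ioo_subset_Icc_self
    · exact Subset.rfl
    · exact Ioo_subset_Ioc_self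
    · exact Ioo_subset_Ico_self
  have hout : S ⊆ Icc a b := by
    rcases hS with rfl | rfl | rfl | rfl
    · exact Subset.rfl
    · exact Ioo_subset_Icc_self
    · exact Ioc_subset_Icc_self
    · exact Ico_subset_Icc_self
  have one : ∀ y, a < y → y < b → S.indicator (fun _ => (1 : ℝ)) y = 1 := fun y h1 h2 =>
    indicator_of_mem (hin ⟨h1, h2⟩) _
  have zero1 : ∀ y, y < a → S.indicator (fun _ => (1 : ℝ)) y = 0 := fun y h1 =>
    indicator_of_notMem (fun h => absurd (hout h).1 (not_le.2 h1)) _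
  have zero2 : ∀ y, b < y → S.indicator (fun _ => (1 : ℝ)) y = 0 := fun y h1 =>
    indicator_of_notMem (fun h => absurd (hout h).2 (not_le.2 h1)) _
  refine ⟨tendsto_const_nhds.congr' ?_, tendsto_const_nhds.congr' ?_⟩
  · by_cases h1 : a < x
    · by_cases h2 : x ≤ b
      · filter_upwards [Ioo_mem_nhdsLT h1] with y hy
        rw [if_pos ⟨h1, h2⟩, one y hy.1 (hy.2.trans_le h2)]
      · filter_upwards [Ioo_mem_nhdsLT (not_le.1 h2)] with y hy
        rw [if_neg (fun h => h2 h.2), zero2 y hy.1]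
    · filter_upwards [self_mem_nhdsWithin] with y (hy : y < x)
      rw [if_neg (fun h => h1 h.1), zero1 y (hy.trans_le (not_lt.1 h1))]
  · by_cases h1 : x < b
    · by_cases h2 : a ≤ x
      · filter_upwards [Ioo_mem_nhdsGT h1] with y hy
        rw [if_pos ⟨h2, h1⟩, one y (h2.trans_lt hy.1) hy.2]
      · filter_upwards [Ioo_mem_nhdsGT (not_le.1 h2)] with y hy
        rw [if_neg (fun h => h2 h.1), zero1 y hy.2]
    · filter_upwards [self_mem_nhdsWithin] with y (hy : x < y)
      rw [if_neg (fun h => h1 h.2), zero2 y ((not_lt.1 h1).trans_lt hy)]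

theorem indicator_limits_self {a : ℝ} {S : Set ℝ} (hS : IsIntervalBetween S a a) (x : ℝ) :
    Tendsto (S.indicator (fun _ => (1 : ℝ))) (𝓝[<] x) (𝓝 0) ∧
    Tendsto (S.indicator (fun _ => (1 : ℝ))) (𝓝[>] x) (𝓝 0) := by
  have hout : S ⊆ {a} := by
    rcases hS with rfl | rfl | rfl | rfl <;> simp
  have zero : ∀ y, y ≠ a → S.indicator (fun _ => (1 : ℝ)) y = 0 := fun y h1 =>
    indicator_of_notMem (fun h => h1 (hout h)) _
  have key : ∀ᶠ y in 𝓝[≠] x, y ≠ a := by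
    by_cases h : x = a
    · subst h; exact self_mem_nhdsWithin
    · exact mem_nhdsWithin_of_mem_nhds (isOpen_ne.mem_nhds h)
  refine ⟨tendsto_const_nhds.congr' ?_, tendsto_const_nhds.congr' ?_⟩
  · filter_upwards [nhdsWithin_mono x (fun y (hy : y < x) => hy.ne) key] with y hy
    rw [zero y hy]
  · filter_upwards [nhdsWithin_mono x (fun y (hy : x < y) => hy.ne') key] with y hy
    rw [zero y hy]

/-- A step function has one-sided limits everywhere, and they differ at finitely many points
of `[0,T]` only. -/
theorem exists_jumps {T : ℝ} (f : stepFunctions T) :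
    ∃ w : Icc (0 : ℝ) T →₀ ℝ,
      (∀ x : ℝ, ∃ a b, Tendsto (f : ℝ → ℝ) (𝓝[<] x) (𝓝 a) ∧
        Tendsto (f : ℝ → ℝ) (𝓝[>] x) (𝓝 b)) ∧
      ∀ x : Icc (0 : ℝ) T, ∃ a b, Tendsto (f : ℝ → ℝ) (𝓝[<] (x : ℝ)) (𝓝 a) ∧
        Tendsto (f : ℝ → ℝ) (𝓝[>] (x : ℝ)) (𝓝 b) ∧ w x = a - b := by
  obtain ⟨f, hf⟩ := f
  induction hf using Submodule.span_induction with
  | mem f hf =>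
    obtain ⟨s, t, hst, S, hS, rfl⟩ := hf
    rcases hst.eq_or_lt with h | h
    · subst h
      refine ⟨0, fun x => ⟨0, 0, indicator_limits_self hS x⟩,
        fun x => ⟨0, 0, (indicator_limits_self hS x).1, (indicator_limits_self hS x).2, by simp⟩⟩
    · have h' : (s : ℝ) < t := h
      refine ⟨Finsupp.single t 1 - Finsupp.single s 1,
        fun x => ⟨_, _, indicator_limits h' hS x⟩,
        fun x => ⟨_, _, (indicator_limits h' hS x).1, (indicator_limits h' hS x).2, ?_⟩⟩
      rw [Finsupp.sub_apply, Finsupp.single_apply, Finsupp.single_apply]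
      have e1 : t = x ↔ (t : ℝ) = x := Subtype.ext_iff
      have e2 : s = x ↔ (s : ℝ) = x := Subtype.ext_iff
      simp only [e1, e2]
      grind
  | zero =>
    exact ⟨0, fun x => ⟨0, 0, tendsto_const_nhds, tendsto_const_nhds⟩,
      fun x => ⟨0, 0, tendsto_const_nhds, tendsto_const_nhds, by simp⟩⟩
  | add f g hf hg ihf ihg =>
    obtain ⟨w, hw, hw'⟩ := ihf
    obtain ⟨v, hv, hv'⟩ := ihg
    refine ⟨w + v, fun x => ?_, fun x => ?_⟩
    · obtain ⟨a, b, h1, h2⟩ := hw x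
      obtain ⟨a', b', h1', h2'⟩ := hv x
      exact ⟨_, _, h1.add h1', h2.add h2'⟩
    · obtain ⟨a, b, h1, h2, h3⟩ := hw' x
      obtain ⟨a', b', h1', h2', h3'⟩ := hv' x
      refine ⟨_, _, h1.add h1', h2.add h2', ?_⟩
      rw [Finsupp.add_apply, h3, h3']
      ring
  | smul c f hf ihf =>
    obtain ⟨w, hw, hw'⟩ := ihf
    refine ⟨c • w, fun x => ?_, fun x => ?_⟩
    · obtain ⟨a, b, h1, h2⟩ := hw x
      exact ⟨_, _, h1.const_mul c, h2.const_mul c⟩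
    · obtain ⟨a, b, h1, h2, h3⟩ := hw' x
      refine ⟨_, _, h1.const_mul c, h2.const_mul c, ?_⟩
      rw [Finsupp.smul_apply, h3, smul_eq_mul]
      ring

theorem tendsto_leftLim {T : ℝ} (f : stepFunctions T) (x : ℝ) :
    Tendsto (f : ℝ → ℝ) (𝓝[<] x) (𝓝 (Function.leftLim (f : ℝ → ℝ) x)) := by
  obtain ⟨_, h, _⟩ := exists_jumps f
  obtain ⟨a, b, ha, _⟩ := h x
  exact tendsto_leftLim_of_tendsto ⟨a, ha⟩

theorem tendsto_rightLim {T : ℝ} (f : stepFunctions T) (x : ℝ) :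
    Tendsto (f : ℝ → ℝ) (𝓝[>] x) (𝓝 (Function.rightLim (f : ℝ → ℝ) x)) := by
  obtain ⟨_, h, _⟩ := exists_jumps f
  obtain ⟨a, b, _, hb⟩ := h x
  exact tendsto_rightLim_of_tendsto ⟨b, hb⟩

theorem finite_jumps {T : ℝ} (f : stepFunctions T) :
    (Function.support fun x : Icc (0 : ℝ) T =>
      Function.leftLim (f : ℝ → ℝ) x - Function.rightLim (f : ℝ → ℝ) x).Finite := by
  obtain ⟨w, _, h⟩ := exists_jumps f
  refine w.support.finite_toSet.subset fun x hx => ?_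
  obtain ⟨a, b, ha, hb, hab⟩ := h x
  have h1 := leftLim_eq_of_tendsto ha
  have h2 := rightLim_eq_of_tendsto hb
  rw [Function.mem_support, h1, h2, ← hab] at hx
  simpa using hx

/-- The jumps `f(x-) - f(x+)`, `x ∈ [0,T]`, of a step function `f` (which vanishes off `[0,T]`),
as a finitely supported function. The indicator of an interval with end points `s < t` is sent
to `δ_t - δ_s`. -/
def jumps (T : ℝ) : stepFunctions T →ₗ[ℝ] (Icc (0 : ℝ) T →₀ ℝ) where
  toFun f := Finsupp.ofSupportFinite
    (fun x => Function.leftLim (f : ℝ → ℝ) x - Function.rightLim (f : ℝ → ℝ) x) (finite_jumps f)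
  map_add' f g := by
    ext x
    simp only [Finsupp.ofSupportFinite_coe, Finsupp.add_apply]
    have h1 : Function.leftLim ((f + g : stepFunctions T) : ℝ → ℝ) x = _ :=
      leftLim_eq_of_tendsto ((tendsto_leftLim f x).add (tendsto_leftLim g x))
    have h2 : Function.rightLim ((f + g : stepFunctions T) : ℝ → ℝ) x = _ :=
      rightLim_eq_of_tendsto ((tendsto_rightLim f x).add (tendsto_rightLim g x))
    rw [h1, h2]
    ring
  map_smul' c f := by
    ext x
    simp only [Finsupp.ofSupportFinite_coe, Finsupp.smul_apply, RingHom.id_apply, smul_eq_mul]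
    have h1 : Function.leftLim ((c • f : stepFunctions T) : ℝ → ℝ) x = _ :=
      leftLim_eq_of_tendsto ((tendsto_leftLim f x).const_mul c)
    have h2 : Function.rightLim ((c • f : stepFunctions T) : ℝ → ℝ) x = _ :=
      rightLim_eq_of_tendsto ((tendsto_rightLim f x).const_mul c)
    rw [h1, h2]
    ring

theorem jumps_intervalStep {T : ℝ} (s t : Icc (0 : ℝ) T) (hst : s ≤ t) (S : Set ℝ)
    (hS : IsIntervalBetween S s t) :
    jumps T (intervalStep s t hst S hS) = Finsupp.single t 1 - Finsupp.single s 1 := by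
  ext x
  change Function.leftLim (S.indicator fun _ => (1 : ℝ)) x
    - Function.rightLim (S.indicator fun _ => (1 : ℝ)) x = _
  rcases hst.eq_or_lt with h | h
  · subst h
    rw [leftLim_eq_of_tendsto (indicator_limits_self hS x).1,
      rightLim_eq_of_tendsto (indicator_limits_self hS x).2]
    simp
  · have h' : (s : ℝ) < t := h
    rw [leftLim_eq_of_tendsto (indicator_limits h' hS x).1,
      rightLim_eq_of_tendsto (indicator_limits h' hS x).2,
      Finsupp.sub_apply, Finsupp.single_apply, Finsupp.single_apply]
    have e1 : t = x ↔ (t : ℝ) = x := Subtype.ext_iff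
    have e2 : s = x ↔ (s : ℝ) = x := Subtype.ext_iff
    simp only [e1, e2]
    grind

/-! ### The Cameron–Martin space and the map `J` -/

section CameronMartin

variable {Ω : Type*} [MeasurableSpace Ω] {P : Measure Ω} {T : ℝ} {X : Icc (0 : ℝ) T → Ω → ℝ}

/-- The Hilbert space `H`, the closed linear span of the `X_t` in `L²(P)`. -/
def gaussianHilbertSpace (hX : ∀ t, MemLp (X t) 2 P) : Submodule ℝ (Lp ℝ 2 P) :=
  (Submodule.span ℝ (range fun t => (hX t).toLp (X t))).topologicalClosure

/-- `X_t` as an element of `H`. -/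
def evalH (hX : ∀ t, MemLp (X t) 2 P) (t : Icc (0 : ℝ) T) : gaussianHilbertSpace hX :=
  ⟨(hX t).toLp (X t), Submodule.le_topologicalClosure _ (Submodule.subset_span ⟨t, rfl⟩)⟩

/-- The map `U`, `U(Z)(t) = E[Z X_t]`, from `H` to the functions on `[0,T]`. -/
def mapU (hX : ∀ t, MemLp (X t) 2 P) :
    gaussianHilbertSpace hX →ₗ[ℝ] (Icc (0 : ℝ) T → ℝ) where
  toFun Z t := ∫ ω, (Z : Lp ℝ 2 P) ω * X t ω ∂P
  map_add' Z Z' := by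
    funext t
    have h : ∀ Y : Lp ℝ 2 P, Integrable (fun ω => Y ω * X t ω) P := fun Y =>
      (Lp.memLp Y).integrable_mul (hX t)
    rw [Pi.add_apply, ← integral_add (h _) (h _)]
    refine integral_congr_ae ?_
    filter_upwards [Lp.coeFn_add (Z : Lp ℝ 2 P) (Z' : Lp ℝ 2 P)] with ω hω
    rw [Submodule.coe_add, hω, Pi.add_apply, add_mul]
  map_smul' c Z := by
    funext t
    rw [Pi.smul_apply, RingHom.id_apply, smul_eq_mul, ← integral_const_mul]
    refine integral_congr_ae ?_
    filter_upwards [Lp.coeFn_smul c (Z : Lp ℝ 2 P)] with ω hω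
    rw [Submodule.coe_smul, hω, Pi.smul_apply, smul_eq_mul, mul_assoc]

theorem mapU_apply_eq_inner (hX : ∀ t, MemLp (X t) 2 P) (Z : gaussianHilbertSpace hX)
    (t : Icc (0 : ℝ) T) : mapU hX Z t = inner ℝ ((hX t).toLp (X t)) (Z : Lp ℝ 2 P) := by
  rw [L2.inner_def]
  refine integral_congr_ae ?_
  filter_upwards [(hX t).coeFn_toLp] with ω hω
  rw [hω]
  simp

theorem mapU_injective (hX : ∀ t, MemLp (X t) 2 P) : Function.Injective (mapU hX) := by
  rw [injective_iff_map_eq_zero]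
  rintro ⟨Z, hZ⟩ h
  have h0 : ∀ Y ∈ gaussianHilbertSpace hX, inner ℝ Y Z = 0 := by
    intro Y hY
    have hcl : IsClosed {Y : Lp ℝ 2 P | inner ℝ Y Z = 0} :=
      isClosed_eq (continuous_id.inner continuous_const) continuous_const
    refine closure_minimal ?_ hcl hY
    intro Y hY
    induction hY using Submodule.span_induction with
    | mem Y hY =>
      obtain ⟨t, rfl⟩ := hY
      have := congrFun h t
      rw [mapU_apply_eq_inner] at this
      exact this
    | zero => simp
    | add Y Y' _ _ h1 h2 =>
      change inner ℝ Y Z = 0 at h1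
      change inner ℝ Y' Z = 0 at h2
      change inner ℝ (Y + Y') Z = 0
      rw [inner_add_left, h1, h2, add_zero]
    | smul c Y _ h1 =>
      change inner ℝ Y Z = 0 at h1
      change inner ℝ (c • Y) Z = 0
      rw [inner_smul_left, h1, mul_zero]
  exact Subtype.ext (inner_self_eq_zero.1 (h0 Z hZ))

/-- The Cameron–Martin space `K_X = {t ↦ E[Z X_t] : Z ∈ H}`. -/
def cameronMartin (hX : ∀ t, MemLp (X t) 2 P) : Submodule ℝ (Icc (0 : ℝ) T → ℝ) :=
  LinearMap.range (mapU hX)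

/-- `U` as a linear bijection from `H` onto `K_X`. -/
def equivU (hX : ∀ t, MemLp (X t) 2 P) : gaussianHilbertSpace hX ≃ₗ[ℝ] cameronMartin hX :=
  LinearEquiv.ofInjective (mapU hX) (mapU_injective hX)

/-- The scalar product of `K_X`: `⟨k₁, k₂⟩_X = E[Z₁ Z₂]` if `k_i = E[Z_i X_·]`. -/
def cmInner (hX : ∀ t, MemLp (X t) 2 P) (k₁ k₂ : cameronMartin hX) : ℝ :=
  ∫ ω, ((equivU hX).symm k₁ : Lp ℝ 2 P) ω * ((equivU hX).symm k₂ : Lp ℝ 2 P) ω ∂P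

theorem cmInner_eq_inner (hX : ∀ t, MemLp (X t) 2 P) (k₁ k₂ : cameronMartin hX) :
    cmInner hX k₁ k₂ = inner ℝ ((equivU hX).symm k₁) ((equivU hX).symm k₂) := by
  rw [Submodule.coe_inner, L2.inner_def]
  refine integral_congr_ae (Eventually.of_forall fun ω => ?_)
  exact mul_comm _ _

/-- The covariance function `Γ^X(s,t) = E[X_s X_t]` of the (centered) process `X`. -/
def covFun (P : Measure Ω) (X : Icc (0 : ℝ) T → Ω → ℝ) (s t : Icc (0 : ℝ) T) : ℝ :=
  ∫ ω, X s ω * X t ω ∂P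

theorem mapU_evalH (hX : ∀ t, MemLp (X t) 2 P) (s : Icc (0 : ℝ) T) :
    mapU hX (evalH hX s) = covFun P X s := by
  funext t
  refine integral_congr_ae ?_
  filter_upwards [(hX s).coeFn_toLp] with ω hω
  change ((hX s).toLp (X s)) ω * X t ω = _
  rw [hω]

/-- The function `Γ^X(s,·)` as an element of `K_X`. -/
def kernelCM (hX : ∀ t, MemLp (X t) 2 P) (s : Icc (0 : ℝ) T) : cameronMartin hX :=
  ⟨covFun P X s, evalH hX s, mapU_evalH hX s⟩

/-- The linear map `J` from step functions to `K_X` with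
`J 1_{|s,t|} = Γ^X(t,·) - Γ^X(s,·)`, see `mapJ_intervalStep`. -/
def mapJ (hX : ∀ t, MemLp (X t) 2 P) : stepFunctions T →ₗ[ℝ] cameronMartin hX :=
  Finsupp.linearCombination ℝ (kernelCM hX) ∘ₗ jumps T

theorem mapJ_intervalStep (hX : ∀ t, MemLp (X t) 2 P) (s t : Icc (0 : ℝ) T) (hst : s ≤ t)
    (S : Set ℝ) (hS : IsIntervalBetween S s t) :
    mapJ hX (intervalStep s t hst S hS) = kernelCM hX t - kernelCM hX s := by
  simp [mapJ, jumps_intervalStep]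

/-- The bilinear form `⟨f, g⟩_J = ⟨J f, J g⟩_X` on step functions. -/
def innerJ (hX : ∀ t, MemLp (X t) 2 P) (f g : stepFunctions T) : ℝ :=
  cmInner hX (mapJ hX f) (mapJ hX g)

/-- The seminorm `‖f‖_J` on step functions. -/
def normJ (hX : ∀ t, MemLp (X t) 2 P) (f : stepFunctions T) : ℝ := √(innerJ hX f f)

/-! ### The domain `F` of the Wiener integral -/

/-- `⟨·,·⟩_J` is symmetric, bilinear and positive semidefinite. -/
@[reducible]
def coreJ (hX : ∀ t, MemLp (X t) 2 P) : PreInnerProductSpace.Core ℝ (stepFunctions T) where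
  inner f g := innerJ hX f g
  conj_inner_symm f g := by
    simp only [innerJ, cmInner_eq_inner, conj_trivial]
    exact real_inner_comm ((equivU hX).symm (mapJ hX f)) ((equivU hX).symm (mapJ hX g))
  re_inner_nonneg f := by
    simp only [innerJ, cmInner_eq_inner]
    exact real_inner_self_nonneg (x := (equivU hX).symm (mapJ hX f))
  add_left f g h := by
    simp only [innerJ, cmInner_eq_inner, map_add]
    exact inner_add_left ((equivU hX).symm (mapJ hX f)) ((equivU hX).symm (mapJ hX g))
      ((equivU hX).symm (mapJ hX h))
  smul_left f g c := by
    simp only [innerJ, cmInner_eq_inner, map_smul, conj_trivial]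
    exact real_inner_smul_left ((equivU hX).symm (mapJ hX f)) ((equivU hX).symm (mapJ hX g)) c

/-- The space of step functions, equipped with `⟨·,·⟩_J`. -/
def StepJ (_hX : ∀ t, MemLp (X t) 2 P) : Type := stepFunctions T

instance (hX : ∀ t, MemLp (X t) 2 P) : SeminormedAddCommGroup (StepJ hX) :=
  @InnerProductSpace.Core.toSeminormedAddCommGroup ℝ (stepFunctions T) _ _ _ (coreJ hX)

instance (hX : ∀ t, MemLp (X t) 2 P) : InnerProductSpace ℝ (StepJ hX) :=
  InnerProductSpace.ofCore (F := stepFunctions T) (coreJ hX)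

theorem norm_stepJ (hX : ∀ t, MemLp (X t) 2 P) (f : stepFunctions T) :
    ‖(show StepJ hX from f)‖ = normJ hX f := rfl

/-- The quotient of the step functions by the relation `⟨f - g, f - g⟩_J = 0`,
that is, by distance zero for `‖·‖_J`. -/
abbrev QuotientJ (hX : ∀ t, MemLp (X t) 2 P) : Type := SeparationQuotient (StepJ hX)

/-- The domain `F` of the Wiener integral: the completion of the quotient for `⟨·,·⟩_J`. -/
abbrev WienerDomain (hX : ∀ t, MemLp (X t) 2 P) : Type :=
  UniformSpace.Completion (QuotientJ hX)

/-- The element of `F` that a step function represents. -/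
def toWienerDomain (hX : ∀ t, MemLp (X t) 2 P) (f : stepFunctions T) : WienerDomain hX :=
  ((SeparationQuotient.mk (show StepJ hX from f) : QuotientJ hX) : WienerDomain hX)

end CameronMartin

/-! ### Ornstein–Uhlenbeck processes -/

/-- `X` is a centered Ornstein–Uhlenbeck process on `[0,T]`: a process with continuous paths
solving `dX_t = -θ X_t dt + σ dW_t` (in integrated form), where `W` is a standard Brownian motion
and `X_0` has law `N(0, σ₀²)` and is independent of `W`. -/
structure IsCenteredOU {Ω : Type*} [MeasurableSpace Ω] (P : Measure Ω) {T : ℝ} (hT : 0 ≤ T)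
    (θ σ : ℝ) (σ₀ : ℝ≥0) (W : ℝ≥0 → Ω → ℝ) (X : Icc (0 : ℝ) T → Ω → ℝ) : Prop where
  brownian : IsBrownianReal W P
  law_init : HasLaw (X ⟨0, le_rfl, hT⟩) (gaussianReal 0 (σ₀ ^ 2)) P
  indep_init : IndepFun (X ⟨0, le_rfl, hT⟩) (fun ω t => W t ω) P
  continuous_paths : ∀ᵐ ω ∂P, Continuous fun t => X t ω
  sde : ∀ᵐ ω ∂P, ∀ t : Icc (0 : ℝ) T,
    X t ω = X ⟨0, le_rfl, hT⟩ ω - θ * (∫ s in (0 : ℝ)..t, IccExtend hT (fun r => X r ω) s)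
      + σ * W ⟨t, t.2.1⟩ ω

end

end WienerOU

namespace WienerOU

/-! ### Integration of step functions -/

section StepFunctions

/-! In `L²(P)` the process is a continuous curve `x` with `x(t) = x₀ + σ w(t) - θ ∫_0^t x`, where
`⟨w(s), w(t)⟩ = min s t` and `x₀ ⊥ w`. As `U` is isometric and maps `X_t` to `Γ^X(t,·)`, `‖f‖_J` is
the norm of the elementary integral `∫ f dx`, written `jumpSum x f` (`normJ_eq`). Everything thus
reduces to two estimates for a curve in a Hilbert space.

Upper bound: `∫ f dx = σ ∫ f dw - θ ∫ f x ds` by summation by parts (`jumpSum_primitive`). The first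
term is controlled by the Itô isometry, the second by Cauchy–Schwarz and the boundedness of `x` on
`[0,T]`.

Lower bound, by duality: with `F = ∫_0^· f`, take `Y = ∫ (f + θF) dw`. Then `⟨Y, x(t)⟩` solves the
scalar Volterra equation with forcing `σ(F + θ ∫_0^· F)`, whose solution is `σF`. Hence `⟨Y, ∫ f dx⟩
= σ‖f‖₂²`, while `‖Y‖ ≤ D‖f‖₂` with `D` independent of `f`; Cauchy–Schwarz gives `(σ/D)‖f‖₂ ≤
‖f‖_J`.

Step functions are dense both in `F` and in `L²([0,T])`, so equivalence of the norms extends the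
identity to a homeomorphism of the two complete spaces. -/

theorem IsIntervalBetween.measurableSet {S : Set ℝ} {a b : ℝ} (h : IsIntervalBetween S a b) :
    MeasurableSet S := by
  rcases h with rfl | rfl | rfl | rfl
  · exact measurableSet_Icc
  · exact measurableSet_Ioo
  · exact measurableSet_Ioc
  · exact measurableSet_Ico

theorem IsIntervalBetween.subset_Icc {S : Set ℝ} {a b : ℝ} (h : IsIntervalBetween S a b) :
    S ⊆ Icc a b := by
  rcases h with rfl | rfl | rfl | rfl
  · exact Subset.rfl
  · exact Ioo_subset_Icc_self
  · exact Ioc_subset_Icc_self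
  · exact Ico_subset_Icc_self

theorem IsIntervalBetween.ae_eq_Ioc {S : Set ℝ} {a b : ℝ} (h : IsIntervalBetween S a b) :
    S =ᵐ[volume] Ioc a b := by
  rcases h with rfl | rfl | rfl | rfl
  · exact Ioc_ae_eq_Icc.symm
  · exact Ioo_ae_eq_Ioc
  · exact ae_eq_refl _
  · exact Ico_ae_eq_Ioc

@[elab_as_elim]
theorem step_induction {T : ℝ} {p : stepFunctions T → Prop}
    (interval : ∀ (s t : Icc (0 : ℝ) T) (hst : s ≤ t) (S : Set ℝ) (hS : IsIntervalBetween S s t),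
      p (intervalStep s t hst S hS))
    (zero : p 0) (add : ∀ f g, p f → p g → p (f + g)) (smul : ∀ (c : ℝ) f, p f → p (c • f))
    (f : stepFunctions T) : p f := by
  obtain ⟨f, hf⟩ := f
  induction hf using Submodule.span_induction with
  | mem f hf =>
    obtain ⟨s, t, hst, S, hS, rfl⟩ := hf
    exact interval s t hst S hS
  | zero => exact zero
  | add f g hf hg ihf ihg => exact add ⟨f, hf⟩ ⟨g, hg⟩ ihf ihg
  | smul c f hf ihf => exact smul c ⟨f, hf⟩ ihf

theorem measurable_step {T : ℝ} (f : stepFunctions T) : Measurable (f : ℝ → ℝ) := by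
  induction f using step_induction with
  | interval s t hst S hS => exact measurable_const.indicator hS.measurableSet
  | zero => exact measurable_const
  | add f g ihf ihg => exact ihf.add ihg
  | smul c f ihf => exact ihf.const_smul c

theorem exists_bound_step {T : ℝ} (f : stepFunctions T) : ∃ C : ℝ, ∀ x, ‖(f : ℝ → ℝ) x‖ ≤ C := by
  induction f using step_induction with
  | interval s t hst S hS =>
    refine ⟨1, fun x => ?_⟩
    change ‖S.indicator (fun _ => (1 : ℝ)) x‖ ≤ 1
    exact (norm_indicator_le_norm_self _ x).trans (by simp)
  | zero => exact ⟨0, fun x => by simp⟩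
  | add f g ihf ihg =>
    obtain ⟨C, hC⟩ := ihf
    obtain ⟨D, hD⟩ := ihg
    exact ⟨C + D, fun x => (norm_add_le _ _).trans (add_le_add (hC x) (hD x))⟩
  | smul c f ihf =>
    obtain ⟨C, hC⟩ := ihf
    refine ⟨‖c‖ * C, fun x => ?_⟩
    change ‖c • (f : ℝ → ℝ) x‖ ≤ _
    rw [norm_smul]
    exact mul_le_mul_of_nonneg_left (hC x) (norm_nonneg c)

variable {T : ℝ}

theorem memLp_step (f : stepFunctions T) (p : ℝ≥0∞) :
    MemLp (f : ℝ → ℝ) p (volume.restrict (Icc 0 T)) := by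
  obtain ⟨C, hC⟩ := exists_bound_step f
  exact MemLp.of_bound (measurable_step f).aestronglyMeasurable C (Eventually.of_forall hC)

theorem integrable_step (f : stepFunctions T) : IntegrableOn (f : ℝ → ℝ) (Icc 0 T) :=
  memLp_one_iff_integrable.1 (memLp_step f 1)

variable {E : Type*} [NormedAddCommGroup E] [NormedSpace ℝ E]

theorem integrable_step_smul (f : stepFunctions T) {g : ℝ → E} (hg : IntegrableOn g (Icc 0 T)) :
    IntegrableOn (fun s => (f : ℝ → ℝ) s • g s) (Icc 0 T) := by
  obtain ⟨C, hC⟩ := exists_bound_step f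
  exact hg.bdd_smul C (measurable_step f).aestronglyMeasurable (Eventually.of_forall hC)

/-- The sum `∑ x (f(x-) - f(x+)) v(x)`. For the values `v` of a process this is the elementary
integral of the step function `f`. -/
noncomputable def jumpSum (v : ℝ → E) : stepFunctions T →ₗ[ℝ] E :=
  Finsupp.linearCombination ℝ (fun t : Icc (0 : ℝ) T => v t) ∘ₗ jumps T

theorem jumpSum_congr {v w : ℝ → E} (h : ∀ t ∈ Icc (0 : ℝ) T, v t = w t) (f : stepFunctions T) :
    jumpSum v f = jumpSum w f := by
  have : (fun t : Icc (0 : ℝ) T => v t) = fun t : Icc (0 : ℝ) T => w t :=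
    funext fun t => h t t.2
  simp only [jumpSum, this]

theorem map_jumpSum {F : Type*} [NormedAddCommGroup F] [NormedSpace ℝ F] (L : E →L[ℝ] F)
    (v : ℝ → E) (f : stepFunctions T) : L (jumpSum v f) = jumpSum (fun t => L (v t)) f := by
  simp [jumpSum, Finsupp.linearCombination_apply, Finsupp.sum]

theorem jumpSum_add (v w : ℝ → E) (f : stepFunctions T) :
    jumpSum (fun t => v t + w t) f = jumpSum v f + jumpSum w f := by
  simp [jumpSum, Finsupp.linearCombination_apply, Finsupp.sum, Finset.sum_add_distrib]

theorem jumpSum_smul (c : ℝ) (v : ℝ → E) (f : stepFunctions T) :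
    jumpSum (fun t => c • v t) f = c • jumpSum v f := by
  simp [jumpSum, Finsupp.linearCombination_apply, Finsupp.sum, Finset.smul_sum, smul_comm c]

/-- Summation by parts for step functions. -/
theorem jumpSum_primitive (p : E) {g : ℝ → E} (hg : IntegrableOn g (Icc 0 T))
    (f : stepFunctions T) :
    jumpSum (fun t => p + ∫ s in (0 : ℝ)..t, g s) f
      = ∫ s in Icc 0 T, (f : ℝ → ℝ) s • g s := by
  induction f using step_induction with
  | interval s t hst S hS =>
    have hst' : (s : ℝ) ≤ t := hst
    rw [jumpSum, LinearMap.comp_apply, jumps_intervalStep, map_sub,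
      Finsupp.linearCombination_single, Finsupp.linearCombination_single, one_smul, one_smul,
      add_sub_add_left_eq_sub]
    have hii : ∀ u : Icc (0 : ℝ) T, IntervalIntegrable g volume 0 u := fun u => by
      rw [intervalIntegrable_iff_integrableOn_Icc_of_le u.2.1]
      exact hg.mono_set (Icc_subset_Icc_right u.2.2)
    rw [intervalIntegral.integral_interval_sub_left (hii t) (hii s),
      intervalIntegral.integral_of_le hst', ← setIntegral_congr_set hS.ae_eq_Ioc]
    have : ∀ x, (intervalStep s t hst S hS : ℝ → ℝ) x • g x = S.indicator g x := fun x => by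
      change S.indicator (fun _ => (1 : ℝ)) x • g x = _
      by_cases hx : x ∈ S <;> simp [hx]
    simp only [this]
    rw [setIntegral_indicator hS.measurableSet,
      inter_eq_right.2 (hS.subset_Icc.trans (Icc_subset_Icc s.2.1 t.2.2))]
  | zero => simp
  | add f₁ f₂ ih₁ ih₂ =>
    rw [map_add, ih₁, ih₂, ← integral_add (integrable_step_smul f₁ hg)
      (integrable_step_smul f₂ hg)]
    refine integral_congr_ae (Eventually.of_forall fun s => ?_)
    exact (add_smul _ _ _).symm
  | smul c f ih =>
    rw [map_smul, ih, ← integral_smul]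
    refine integral_congr_ae (Eventually.of_forall fun s => ?_)
    exact smul_smul _ _ _

theorem l2Norm_nonneg (f : stepFunctions T) : 0 ≤ l2Norm f := Real.sqrt_nonneg _

theorem l2Norm_sq (f : stepFunctions T) : l2Norm f ^ 2 = ∫ t in Icc 0 T, (f : ℝ → ℝ) t ^ 2 :=
  Real.sq_sqrt (integral_nonneg fun _ => sq_nonneg _)

/-- Cauchy–Schwarz against the constant `1`, obtained as nonnegativity of the variance of `|f|`: `A
/ T` is its mean over `[0,T]`. -/
theorem integral_abs_step_le (hT : 0 < T) (f : stepFunctions T) :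
    ∫ s in Icc 0 T, |(f : ℝ → ℝ) s| ≤ √T * l2Norm f := by
  set A := ∫ s in Icc 0 T, |(f : ℝ → ℝ) s| with hA
  have hA0 : 0 ≤ A := integral_nonneg fun _ => abs_nonneg _
  have i1 : IntegrableOn (fun s => |(f : ℝ → ℝ) s|) (Icc 0 T) := (integrable_step f).abs
  have i2 : IntegrableOn (fun s => (f : ℝ → ℝ) s ^ 2) (Icc 0 T) := (memLp_step f 2).integrable_sq
  have key : 0 ≤ ∫ s in Icc 0 T, (|(f : ℝ → ℝ) s| - A / T) ^ 2 :=
    integral_nonneg fun _ => sq_nonneg _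
  have expand : ∫ s in Icc 0 T, (|(f : ℝ → ℝ) s| - A / T) ^ 2
      = l2Norm f ^ 2 - 2 * (A / T) * A + T * (A / T) ^ 2 := by
    have h : ∀ s, (|(f : ℝ → ℝ) s| - A / T) ^ 2
        = ((f : ℝ → ℝ) s ^ 2 - 2 * (A / T) * |(f : ℝ → ℝ) s|) + (A / T) ^ 2 := fun s => by
      rw [sub_sq, sq_abs]; ring
    simp only [h]
    have i3 : IntegrableOn
        (fun s => (f : ℝ → ℝ) s ^ 2 - 2 * (A / T) * |(f : ℝ → ℝ) s|) (Icc 0 T) :=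
      i2.sub (i1.const_mul _)
    rw [integral_add i3 (integrable_const _),
      integral_sub i2 (i1.const_mul _), integral_const_mul, ← hA, l2Norm_sq]
    simp [measureReal_def, hT.le]
  rw [expand] at key
  have hle : A ^ 2 ≤ T * l2Norm f ^ 2 := by
    have h : l2Norm f ^ 2 - 2 * (A / T) * A + T * (A / T) ^ 2 = l2Norm f ^ 2 - A ^ 2 / T := by
      field_simp; ring
    rw [h, sub_nonneg, div_le_iff₀ hT] at key
    linarith
  refine le_of_sq_le_sq ?_ (mul_nonneg (Real.sqrt_nonneg T) (l2Norm_nonneg f))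
  rw [mul_pow, Real.sq_sqrt hT.le]
  exact hle

theorem norm_integral_step_smul_le (hT : 0 < T) (f : stepFunctions T) {v : ℝ → E} {M : ℝ}
    (hM : ∀ s ∈ Icc 0 T, ‖v s‖ ≤ M) :
    ‖∫ s in Icc 0 T, (f : ℝ → ℝ) s • v s‖ ≤ M * (√T * l2Norm f) := by
  have hM0 : 0 ≤ M := (norm_nonneg _).trans (hM 0 ⟨le_rfl, hT.le⟩)
  calc ‖∫ s in Icc 0 T, (f : ℝ → ℝ) s • v s‖
      ≤ ∫ s in Icc 0 T, M * |(f : ℝ → ℝ) s| := by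
        refine norm_integral_le_of_norm_le ((integrable_step f).abs.const_mul M) ?_
        filter_upwards [ae_restrict_mem measurableSet_Icc] with s hs
        rw [norm_smul, Real.norm_eq_abs, mul_comm]
        exact mul_le_mul_of_nonneg_right (hM s hs) (abs_nonneg _)
    _ ≤ M * (√T * l2Norm f) := by
        rw [integral_const_mul]
        exact mul_le_mul_of_nonneg_left (integral_abs_step_le hT f) hM0

/-- `∫_[0,T] f(s) (t - s)⁺ ds = ∫_0^t ∫_0^r f(s) ds dr`. -/
theorem integral_step_mul_sub_min (f : stepFunctions T) {t : ℝ} (ht : t ∈ Icc 0 T) :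
    ∫ s in Icc 0 T, (f : ℝ → ℝ) s * (t - min t s)
      = ∫ r in (0 : ℝ)..t, ∫ s in (0 : ℝ)..r, (f : ℝ → ℝ) s := by
  have hint : Integrable (Function.uncurry fun s r : ℝ => (f : ℝ → ℝ) s * (Iic r).indicator 1 s)
      ((volume.restrict (Icc 0 T)).prod (volume.restrict (Ioc 0 t))) := by
    have h1 : Integrable (fun z : ℝ × ℝ => (f : ℝ → ℝ) z.1 * (1 : ℝ))
        ((volume.restrict (Icc 0 T)).prod (volume.restrict (Ioc 0 t))) :=
      (show Integrable (f : ℝ → ℝ) (volume.restrict (Icc 0 T)) from integrable_step f).mul_prod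
        (integrable_const (1 : ℝ))
    have h2 := h1.indicator (measurableSet_le measurable_fst measurable_snd)
    refine h2.congr (Eventually.of_forall fun z => ?_)
    by_cases hz : z.1 ≤ z.2 <;> simp [Function.uncurry, hz, indicator]
  have hswap := integral_integral_swap hint
  rw [intervalIntegral.integral_of_le ht.1]
  have e1 : ∀ r ∈ Ioc 0 t, ∫ s in (0 : ℝ)..r, (f : ℝ → ℝ) s
      = ∫ s in Icc 0 T, (f : ℝ → ℝ) s * (Iic r).indicator 1 s := fun r hr => by
    have h : ∀ s, (f : ℝ → ℝ) s * (Iic r).indicator 1 s = (Iic r).indicator (f : ℝ → ℝ) s :=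
      fun s => by by_cases hs : s ≤ r <;> simp [hs, indicator]
    simp only [h]
    rw [setIntegral_indicator measurableSet_Iic, intervalIntegral.integral_of_le hr.1.le,
      show Icc 0 T ∩ Iic r = Icc 0 r by ext x; have := hr.2.trans ht.2; simp; grind,
      integral_Icc_eq_integral_Ioc]
  -- `t - min t s` is the length of `{r ∈ [0,t] : s ≤ r}`; the claim is then Fubini for `f(s) 1_{s ≤
  -- r}`.
  have e2 : ∀ s ∈ Icc 0 T, (f : ℝ → ℝ) s * (t - min t s)
      = ∫ r in Ioc 0 t, (f : ℝ → ℝ) s * (Iic r).indicator 1 s := fun s hs => by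
    have h : ∀ r, (Iic r).indicator (1 : ℝ → ℝ) s = (Ici s).indicator 1 r :=
      fun r => by by_cases hs : s ≤ r <;> simp [hs, indicator]
    simp only [h]
    rw [integral_const_mul, ← integral_Icc_eq_integral_Ioc,
      setIntegral_indicator measurableSet_Ici,
      show Icc 0 t ∩ Ici s = Icc s t by ext x; have := hs.1; simp; grind]
    simp only [Pi.one_apply, integral_const, smul_eq_mul, mul_one, measureReal_def,
      MeasurableSet.univ, Measure.restrict_apply, univ_inter, Real.volume_Icc]
    rw [ENNReal.toReal_ofReal']
    congr 1
    rcases le_total t s with h | h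
    · simp [h]
    · simp [h]
  rw [setIntegral_congr_fun measurableSet_Icc e2, setIntegral_congr_fun measurableSet_Ioc e1, hswap]

/-- Exhibits the Brownian covariance as a primitive in `t`, the form that summation by parts needs.
-/
theorem intervalIntegral_indicator_Iic {s t : ℝ} (hs : 0 ≤ s) (ht : 0 ≤ t) :
    ∫ r in (0 : ℝ)..t, (Iic s).indicator (1 : ℝ → ℝ) r = min s t := by
  rw [intervalIntegral.integral_of_le ht, setIntegral_indicator measurableSet_Iic, Ioc_inter_Iic]
  simp [measureReal_def, -ENNReal.ofReal_min, hs, ht, min_comm]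

end StepFunctions

/-! ### The linear Volterra equation `x(t) = y(t) - θ ∫_0^t x` -/

section Volterra

variable {E : Type*} [NormedAddCommGroup E] [NormedSpace ℝ E]

/-- The solution of `x(t) = y(t) - θ ∫_0^t x(s) ds`. -/
noncomputable def volterra (θ : ℝ) (y : ℝ → E) (t : ℝ) : E :=
  y t - (θ * Real.exp (-(θ * t))) • ∫ s in (0 : ℝ)..t, Real.exp (θ * s) • y s

theorem continuous_exp_smul (θ : ℝ) {y : ℝ → E} (hy : Continuous y) :
    Continuous fun s => Real.exp (θ * s) • y s := by fun_prop

variable [CompleteSpace E]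

theorem hasDerivAt_primitive {y : ℝ → E} (hy : Continuous y) (t : ℝ) :
    HasDerivAt (fun t => ∫ s in (0 : ℝ)..t, y s) (y t) t :=
  (hy.integral_hasStrictDerivAt 0 t).hasDerivAt

theorem continuous_volterra (θ : ℝ) {y : ℝ → E} (hy : Continuous y) :
    Continuous (volterra θ y) := by
  have h : Continuous fun t => ∫ s in (0 : ℝ)..t, Real.exp (θ * s) • y s :=
    continuous_iff_continuousAt.2 fun t =>
      (hasDerivAt_primitive (continuous_exp_smul θ hy) t).continuousAt
  unfold volterra
  fun_prop

/-- `volterra θ y` is the derivative of `t ↦ exp(-θt) ∫_0^t exp(θr) y(r) dr`, so its own primitive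
is explicit. -/
theorem volterra_eq (θ : ℝ) {y : ℝ → E} (hy : Continuous y) (t : ℝ) :
    volterra θ y t = y t - θ • ∫ s in (0 : ℝ)..t, volterra θ y s := by
  have hd : ∀ s, HasDerivAt
      (fun s => Real.exp (-(θ * s)) • ∫ r in (0 : ℝ)..s, Real.exp (θ * r) • y r)
      (volterra θ y s) s := fun s => by
    have h1 : HasDerivAt (fun s => Real.exp (-(θ * s))) (Real.exp (-(θ * s)) * -(θ * 1)) s :=
      ((hasDerivAt_id s).const_mul θ).neg.exp
    refine (h1.smul (hasDerivAt_primitive (continuous_exp_smul θ hy) s)).congr_deriv ?_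
    rw [smul_smul, ← Real.exp_add, neg_add_cancel, Real.exp_zero, one_smul, volterra,
      sub_eq_add_neg, ← neg_smul]
    congr 2
    ring
  rw [intervalIntegral.integral_eq_sub_of_hasDerivAt (fun s _ => hd s)
    ((continuous_volterra θ hy).intervalIntegrable _ _)]
  simp [volterra, mul_smul]

/-- Uniqueness by an integrating factor: on `[0,T]` the derivative of `exp(θt) ∫_0^t x` is `exp(θt)
y(t)`, which determines `∫_0^t x` and hence `x(t)`. It serves both for the paths of `X` and for the
scalar function `⟨Y, x(t)⟩`. -/
theorem eq_volterra {θ T : ℝ} {x y : ℝ → E} (hx : Continuous x)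
    (h : ∀ t ∈ Icc 0 T, x t = y t - θ • ∫ s in (0 : ℝ)..t, x s) {t : ℝ} (ht : t ∈ Icc 0 T) :
    x t = volterra θ y t := by
  have hd : ∀ s, HasDerivAt (fun s => Real.exp (θ * s) • ∫ r in (0 : ℝ)..s, x r)
      (Real.exp (θ * s) • x s + (Real.exp (θ * s) * (θ * 1)) • ∫ r in (0 : ℝ)..s, x r) s :=
    fun s => ((hasDerivAt_id s).const_mul θ).exp.smul (hasDerivAt_primitive hx s)
  have hc : Continuous fun s => ∫ r in (0 : ℝ)..s, x r :=
    continuous_iff_continuousAt.2 fun s => (hasDerivAt_primitive hx s).continuousAt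
  have h1 := intervalIntegral.integral_eq_sub_of_hasDerivAt (a := 0) (b := t) (fun s _ => hd s)
    (by apply Continuous.intervalIntegrable; fun_prop)
  have h2 : ∫ s in (0 : ℝ)..t,
        (Real.exp (θ * s) • x s + (Real.exp (θ * s) * (θ * 1)) • ∫ r in (0 : ℝ)..s, x r)
      = ∫ s in (0 : ℝ)..t, Real.exp (θ * s) • y s := by
    refine intervalIntegral.integral_congr fun s hs => ?_
    rw [uIcc_of_le ht.1] at hs
    rw [h s ⟨hs.1, hs.2.trans ht.2⟩, smul_sub, smul_smul, mul_one, sub_add_cancel]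
  rw [h2] at h1
  rw [volterra, h1, h t ht]
  simp only [intervalIntegral.integral_same, smul_zero, sub_zero, smul_smul]
  rw [mul_assoc, ← Real.exp_add, neg_add_cancel, Real.exp_zero, mul_one]

theorem map_volterra {F : Type*} [NormedAddCommGroup F] [NormedSpace ℝ F] [CompleteSpace F]
    (L : E →L[ℝ] F) (θ : ℝ) {y : ℝ → E} (hy : Continuous y) (t : ℝ) :
    L (volterra θ y t) = volterra θ (fun s => L (y s)) t := by
  rw [volterra, volterra, map_sub, map_smul, ← L.intervalIntegral_comp_comm
    ((continuous_exp_smul θ hy).intervalIntegrable _ _)]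
  simp only [map_smul]

end Volterra

/-! ### Integrals of curves in `L²` -/

section LpCurve

variable {Ω : Type*} [MeasurableSpace Ω] {P : Measure Ω}

theorem coeFn_finset_sum {ι : Type*} (s : Finset ι) (u : ι → Lp ℝ 2 P) :
    ⇑(∑ i ∈ s, u i) =ᵐ[P] fun ω => ∑ i ∈ s, u i ω := by
  classical
  induction s using Finset.induction_on with
  | empty =>
    simp only [Finset.sum_empty]
    exact Lp.coeFn_zero ℝ 2 P
  | insert i s hi ih =>
    rw [Finset.sum_insert hi]
    filter_upwards [Lp.coeFn_add (u i) (∑ j ∈ s, u j), ih] with ω h1 h2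
    rw [h1, Pi.add_apply, h2, Finset.sum_insert hi]

/-- Along a simple function only finitely many values of `g` enter, so almost sure identities at
fixed times can be combined. -/
theorem integral_comp_simpleFunc {F : Type*} [NormedAddCommGroup F] [NormedSpace ℝ F]
    [CompleteSpace F] (μ : Measure ℝ) [IsFiniteMeasure μ] (r : SimpleFunc ℝ ℝ) (g : ℝ → F) :
    ∫ s, g (r s) ∂μ = ∑ x ∈ r.range, μ.real (r ⁻¹' {x}) • g x := by
  have h : ∀ s, g (r s) = ∑ x ∈ r.range, (r ⁻¹' {x}).indicator (fun _ => g x) s := fun s => by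
    rw [Finset.sum_eq_single (r s)]
    · simp
    · intro x _ hx
      exact indicator_of_notMem (fun h => hx h.symm) _
    · intro h
      exact absurd (r.mem_range_self s) h
  simp only [h]
  rw [integral_finsetSum _ fun x _ => (integrable_const _).indicator (r.measurableSet_fiber x)]
  refine Finset.sum_congr rfl fun x _ => ?_
  rw [integral_indicator (r.measurableSet_fiber x), setIntegral_const]

/-- Simple functions approximate the identity of `[a,b]` and `g` is bounded there, so dominated
convergence applies. The approximation does not depend on `g`, so the same times serve the curve in
`L²(P)` and every path. -/
theorem tendsto_integral_comp_approxOn {F : Type*} [NormedAddCommGroup F] [NormedSpace ℝ F]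
    {a b : ℝ} (hab : a ≤ b) {g : ℝ → F} (hg : Continuous g) :
    Tendsto (fun n => ∫ s in Icc a b,
      g (SimpleFunc.approxOn id measurable_id (Icc a b) a ⟨le_rfl, hab⟩ n s))
      atTop (𝓝 (∫ s in Icc a b, g s)) := by
  obtain ⟨C, hC⟩ := isCompact_Icc.exists_bound_of_continuousOn (s := Icc a b) hg.continuousOn
  refine tendsto_integral_of_dominated_convergence (fun _ => C) (fun n => ?_)
    (integrable_const _) (fun n => Eventually.of_forall fun s =>
      hC _ (SimpleFunc.approxOn_mem _ _ n s)) ?_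
  · exact ((SimpleFunc.approxOn id measurable_id (Icc a b) a ⟨le_rfl, hab⟩ n).map
      g).aestronglyMeasurable
  · filter_upwards [ae_restrict_mem measurableSet_Icc] with s hs
    exact (hg.tendsto s).comp (SimpleFunc.tendsto_approxOn measurable_id _ (subset_closure hs))

/-- The Bochner integral of a continuous curve in `L²(P)` is the pathwise integral of a version
with continuous paths. -/
theorem coeFn_intervalIntegral {a b : ℝ} (hab : a ≤ b) {u : ℝ → Lp ℝ 2 P} (hu : Continuous u)
    {U : ℝ → Ω → ℝ} (hU : ∀ s, u s =ᵐ[P] U s) (hUc : ∀ᵐ ω ∂P, Continuous fun s => U s ω) :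
    ⇑(∫ s in a..b, u s) =ᵐ[P] fun ω => ∫ s in a..b, U s ω := by
  simp only [intervalIntegral.integral_of_le hab, ← integral_Icc_eq_integral_Ioc]
  set μ : Measure ℝ := volume.restrict (Icc a b)
  let r : ℕ → SimpleFunc ℝ ℝ := SimpleFunc.approxOn id measurable_id (Icc a b) a ⟨le_rfl, hab⟩
  -- The sums converge in `L²(P)`, hence almost surely along a subsequence; pathwise they converge
  -- to the integral of the path, and the two limits must agree.
  obtain ⟨ns, hns, hae⟩ := (tendstoInMeasure_of_tendsto_Lp (tendsto_integral_comp_approxOn hab hu)).exists_seq_tendsto_ae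
  have hsum : ∀ᵐ ω ∂P, ∀ n, (∫ s, u (r n s) ∂μ) ω = ∫ s, U (r n s) ω ∂μ := by
    refine ae_all_iff.2 fun n => ?_
    have h1 : ∀ᵐ ω ∂P, ∀ x ∈ (r n).range, (μ.real (r n ⁻¹' {x}) • u x) ω
        = μ.real (r n ⁻¹' {x}) • U x ω := by
      refine (eventually_all_finset _).2 fun x _ => ?_
      filter_upwards [hU x, Lp.coeFn_smul (μ.real (r n ⁻¹' {x})) (u x)] with ω h1 h2
      rw [h2, Pi.smul_apply, h1]
    rw [integral_comp_simpleFunc]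
    filter_upwards [h1, coeFn_finset_sum (r n).range fun x => μ.real (r n ⁻¹' {x}) • u x]
      with ω h1 h2
    rw [h2, integral_comp_simpleFunc μ (r n) fun s => U s ω]
    exact Finset.sum_congr rfl h1
  filter_upwards [hae, hsum, hUc] with ω h1 h2 h3
  exact tendsto_nhds_unique (h1.congr fun i => h2 (ns i))
    ((tendsto_integral_comp_approxOn hab h3).comp hns.tendsto_atTop)

end LpCurve

/-! ### Brownian and Ornstein–Uhlenbeck curves in a Hilbert space -/

section HilbertCurve

variable {E : Type*} [NormedAddCommGroup E] [InnerProductSpace ℝ E]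

/-- A continuous curve with the covariance of Brownian motion. -/
structure IsBrownianCurve (w : ℝ → E) : Prop where
  continuous : Continuous w
  inner_eq : ∀ s t, 0 ≤ s → 0 ≤ t → inner ℝ (w s) (w t) = min s t

variable {T θ σ : ℝ} {w : ℝ → E} {x₀ : E}

theorem inner_jumpSum (p : E) (v : ℝ → E) (f : stepFunctions T) :
    inner ℝ p (jumpSum v f) = jumpSum (fun t => inner ℝ p (v t)) f :=
  map_jumpSum (innerSL ℝ p) v f

/-- `min t r` is the primitive in `r` of the indicator of `r ≤ t`, so summation by parts leaves the
integral of `f` over `[0,t]`. -/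
theorem IsBrownianCurve.inner_jumpSum (hw : IsBrownianCurve w) (f : stepFunctions T) {t : ℝ}
    (ht : t ∈ Icc 0 T) : inner ℝ (w t) (jumpSum w f) = ∫ s in (0 : ℝ)..t, (f : ℝ → ℝ) s := by
  have h1 : ∀ r ∈ Icc 0 T, inner ℝ (w t) (w r)
      = 0 + ∫ s in (0 : ℝ)..r, (Iic t).indicator (1 : ℝ → ℝ) s := fun r hr => by
    rw [hw.inner_eq t r ht.1 hr.1, intervalIntegral_indicator_Iic ht.1 hr.1, zero_add]
  have h2 : IntegrableOn ((Iic t).indicator (1 : ℝ → ℝ)) (Icc 0 T) :=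
    (integrable_const (1 : ℝ)).indicator measurableSet_Iic
  rw [WienerOU.inner_jumpSum, jumpSum_congr h1, jumpSum_primitive 0 h2,
    intervalIntegral.integral_of_le ht.1, ← integral_Icc_eq_integral_Ioc]
  have h3 : ∀ s, (f : ℝ → ℝ) s • (Iic t).indicator (1 : ℝ → ℝ) s
      = (Iic t).indicator (f : ℝ → ℝ) s :=
    fun s => by by_cases hs : s ≤ t <;> simp [hs, indicator]
  simp only [h3]
  rw [setIntegral_indicator measurableSet_Iic,
    show Icc 0 T ∩ Iic t = Icc 0 t by ext x; have := ht.2; simp; grind]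

/-- The Itô isometry for step functions. -/
theorem IsBrownianCurve.norm_jumpSum (hw : IsBrownianCurve w) (f : stepFunctions T) :
    ‖jumpSum w f‖ = l2Norm f := by
  rw [l2Norm, @norm_eq_sqrt_re_inner ℝ E, RCLike.re_to_real, WienerOU.inner_jumpSum]
  -- The pairing with `w` is again a primitive, now of `f`; a second summation by parts gives `∫
  -- f²`.
  have h : ∀ t ∈ Icc 0 T, inner ℝ (jumpSum w f) (w t)
      = 0 + ∫ s in (0 : ℝ)..t, (f : ℝ → ℝ) s := fun t ht => by
    rw [real_inner_comm, hw.inner_jumpSum f ht, zero_add]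
  rw [jumpSum_congr h, jumpSum_primitive 0 (integrable_step f)]
  simp only [smul_eq_mul, sq]

variable [CompleteSpace E]

/-- The curve solving `dx = -θ x dt + σ dw`, `x(0) = x₀`. -/
noncomputable def ouCurve (θ σ : ℝ) (x₀ : E) (w : ℝ → E) : ℝ → E :=
  volterra θ fun t => x₀ + σ • w t

theorem exists_norm_jumpSum_ouCurve_le (hw : IsBrownianCurve w) (hT : 0 < T) :
    ∃ C, 0 < C ∧ ∀ f : stepFunctions T, ‖jumpSum (ouCurve θ σ x₀ w) f‖ ≤ C * l2Norm f := by
  have hy : Continuous fun t => x₀ + σ • w t := by have := hw.continuous; fun_prop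
  have hx : Continuous (ouCurve θ σ x₀ w) := continuous_volterra θ hy
  obtain ⟨M, hM⟩ := isCompact_Icc.exists_bound_of_continuousOn (s := Icc 0 T) hx.continuousOn
  -- The summand `1` only secures positivity, since `σ` and `θ` may vanish here.
  refine ⟨|σ| + |θ| * (M * √T) + 1, ?_, fun f => ?_⟩
  · have : 0 ≤ M := (norm_nonneg _).trans (hM 0 ⟨le_rfl, hT.le⟩)
    positivity
  have hdecomp : jumpSum (ouCurve θ σ x₀ w) f = σ • jumpSum w f
      + (-θ) • ∫ s in Icc 0 T, (f : ℝ → ℝ) s • ouCurve θ σ x₀ w s := by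
    rw [← jumpSum_primitive x₀ (hx.integrableOn_Icc)]
    have h0 : jumpSum (fun _ => x₀) f = 0 := by
      have := jumpSum_primitive x₀ (integrableOn_zero (s := Icc 0 T) (μ := volume)) f
      simpa using this
    -- The primitive is started at `x₀`; the constant left over is `(1 + θ) • x₀`, and constants
    -- have zero jump sum by `h0`.
    have e : ouCurve θ σ x₀ w = fun t => ((1 + θ) • x₀ + σ • w t)
        + (-θ) • (x₀ + ∫ s in (0 : ℝ)..t, ouCurve θ σ x₀ w s) := by
      funext t
      rw [ouCurve, volterra_eq θ hy t]
      module
    conv_lhs => rw [e]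
    rw [jumpSum_add, jumpSum_add, jumpSum_smul, jumpSum_smul, jumpSum_smul, h0, smul_zero, zero_add]
  rw [hdecomp]
  refine (norm_add_le _ _).trans ?_
  rw [norm_smul, norm_smul, hw.norm_jumpSum, norm_neg, Real.norm_eq_abs, Real.norm_eq_abs]
  have h1 := mul_le_mul_of_nonneg_left (norm_integral_step_smul_le hT f hM) (abs_nonneg θ)
  have h2 := l2Norm_nonneg f
  nlinarith

/-- The curve `x` paired with `∫ (f + θ ∫_0^· f) dw` gives `σ ∫_0^t f`, and the norm of this
integral is controlled by that of `f`. -/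
theorem exists_dual_ouCurve (hw : IsBrownianCurve w) (hT : 0 < T)
    (h₀ : ∀ t, 0 ≤ t → inner ℝ x₀ (w t) = 0) (f : stepFunctions T) :
    ∃ Y : E, ‖Y‖ ≤ (1 + |θ| * (√T * √T)) * l2Norm f ∧
      ∀ t ∈ Icc 0 T, inner ℝ Y (ouCurve θ σ x₀ w t)
        = σ * ∫ s in (0 : ℝ)..t, (f : ℝ → ℝ) s := by
  have hwc := hw.continuous
  have hy : Continuous fun t => x₀ + σ • w t := by fun_prop
  have hv : Continuous fun s => w T - w s := by fun_prop
  have hvi : IntegrableOn (fun s => (f : ℝ → ℝ) s • (w T - w s)) (Icc 0 T) :=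
    integrable_step_smul f hv.integrableOn_Icc
  have hvn : ∀ s ∈ Icc 0 T, ‖w T - w s‖ ≤ √T := fun s hs => by
    refine Real.le_sqrt_of_sq_le ?_
    rw [@norm_sub_sq_real, ← real_inner_self_eq_norm_sq, ← real_inner_self_eq_norm_sq,
      hw.inner_eq T T hT.le hT.le, hw.inner_eq T s hT.le hs.1, hw.inner_eq s s hs.1 hs.1,
      min_self, min_self, min_eq_right hs.2]
    linarith [hs.1]
  -- By Fubini `V` stands for `∫ F dw` with `F = ∫_0^· f`. This form avoids integrating against `w`
  -- a function that is not a step function.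
  set V := ∫ s in Icc 0 T, (f : ℝ → ℝ) s • (w T - w s) with hV
  refine ⟨jumpSum w f + θ • V, ?_, ?_⟩
  · refine (norm_add_le _ _).trans ?_
    rw [hw.norm_jumpSum, norm_smul, Real.norm_eq_abs]
    have := mul_le_mul_of_nonneg_left (norm_integral_step_smul_le hT f hvn) (abs_nonneg θ)
    linarith
  have hx₀ : inner ℝ (jumpSum w f + θ • V) x₀ = 0 := by
    rw [real_inner_comm, inner_add_right, inner_smul_right, WienerOU.inner_jumpSum, hV,
      ← integral_inner hvi]
    have h1 : jumpSum (fun t => inner ℝ x₀ (w t)) f = 0 := by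
      rw [jumpSum_congr (w := fun t => (0 : ℝ) + ∫ s in (0 : ℝ)..t, (0 : ℝ))
        (fun t ht => by simp [h₀ t ht.1]), jumpSum_primitive 0 integrableOn_zero]
      simp
    have h2 : ∫ s in Icc 0 T, inner ℝ x₀ ((f : ℝ → ℝ) s • (w T - w s)) = 0 := by
      refine setIntegral_eq_zero_of_forall_eq_zero fun s hs => ?_
      rw [inner_smul_right, inner_sub_right, h₀ T hT.le, h₀ s hs.1]
      simp
    rw [h1, h2, mul_zero, add_zero]
  have hwt : ∀ t ∈ Icc 0 T, inner ℝ (jumpSum w f + θ • V) (w t)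
      = (∫ s in (0 : ℝ)..t, (f : ℝ → ℝ) s)
        + θ * ∫ r in (0 : ℝ)..t, ∫ s in (0 : ℝ)..r, (f : ℝ → ℝ) s := fun t ht => by
    rw [real_inner_comm, inner_add_right, inner_smul_right, hw.inner_jumpSum f ht, hV,
      ← integral_inner hvi, ← integral_step_mul_sub_min f ht]
    congr 2
    refine setIntegral_congr_fun measurableSet_Icc fun s hs => ?_
    rw [inner_smul_right, inner_sub_right, hw.inner_eq t T ht.1 hT.le,
      hw.inner_eq t s ht.1 hs.1, min_eq_left ht.2]
  have hfi : ∀ a b, IntervalIntegrable (f : ℝ → ℝ) volume a b := fun a b => by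
    obtain ⟨C, hC⟩ := exists_bound_step f
    rw [intervalIntegrable_iff]
    exact Measure.integrableOn_of_bounded (by simp) (measurable_step f).aestronglyMeasurable
      (Eventually.of_forall hC)
  have hFc : Continuous fun t => σ * ∫ s in (0 : ℝ)..t, (f : ℝ → ℝ) s :=
    continuous_const.mul (intervalIntegral.continuous_primitive hfi 0)
  intro t ht
  have hm := map_volterra (innerSL ℝ (jumpSum w f + θ • V)) θ hy t
  refine hm.trans (Eq.symm ?_)
  -- `σF` solves the equation with forcing `⟨Y, x₀ + σ w⟩ = σ(F + θ ∫_0^· F)`, because the two terms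
  -- in `θ` cancel.
  refine eq_volterra (θ := θ) (T := T) hFc (fun r hr => ?_) ht
  simp only [innerSL_apply_apply, inner_add_right (jumpSum w f + θ • V), inner_smul_right]
  rw [hx₀, hwt r hr, intervalIntegral.integral_const_mul, smul_eq_mul]
  ring

/-- Testing the integral against the dual vector `Y` gives `σ‖f‖₂² ≤ D‖f‖₂ ‖∫ f dx‖`, where `D` is
the constant of `exists_dual_ouCurve`. -/
theorem exists_le_norm_jumpSum_ouCurve (hw : IsBrownianCurve w) (hT : 0 < T) (hσ : 0 < σ)
    (h₀ : ∀ t, 0 ≤ t → inner ℝ x₀ (w t) = 0) :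
    ∃ c, 0 < c ∧ ∀ f : stepFunctions T, c * l2Norm f ≤ ‖jumpSum (ouCurve θ σ x₀ w) f‖ := by
  set D := 1 + |θ| * (√T * √T) with hD
  have hD0 : 0 < D := by positivity
  refine ⟨σ / D, div_pos hσ hD0, fun f => ?_⟩
  obtain ⟨Y, hY, hYx⟩ := exists_dual_ouCurve (θ := θ) (σ := σ) hw hT h₀ f
  have hp : inner ℝ Y (jumpSum (ouCurve θ σ x₀ w) f) = σ * l2Norm f ^ 2 := by
    rw [inner_jumpSum, jumpSum_congr (w := fun t => σ • (0 + ∫ s in (0 : ℝ)..t, (f : ℝ → ℝ) s))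
      (fun t ht => by rw [hYx t ht, zero_add, smul_eq_mul]), jumpSum_smul,
      jumpSum_primitive 0 (integrable_step f), l2Norm_sq, smul_eq_mul]
    simp only [smul_eq_mul, sq]
  have hle := (real_inner_le_norm Y (jumpSum (ouCurve θ σ x₀ w) f)).trans
    (mul_le_mul_of_nonneg_right hY (norm_nonneg _))
  rw [hp] at hle
  rcases (l2Norm_nonneg f).eq_or_lt with h | h
  · rw [← h, mul_zero]
    exact norm_nonneg _
  · rw [div_mul_eq_mul_div, div_le_iff₀ hD0]
    refine le_of_mul_le_mul_right ?_ h
    nlinarith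

end HilbertCurve

/-! ### Density of step functions -/

section Density

variable {T : ℝ}

/-- The class of a step function in `L²([0,T])`. -/
noncomputable def stepToLp (T : ℝ) :
    stepFunctions T →ₗ[ℝ] Lp ℝ 2 (volume.restrict (Icc (0 : ℝ) T)) where
  toFun f := (memLp_step f 2).toLp f
  map_add' f g := (memLp_step f 2).toLp_add (memLp_step g 2)
  map_smul' c f := (memLp_step f 2).toLp_const_smul c

theorem inner_stepToLp (f : stepFunctions T) (g : Lp ℝ 2 (volume.restrict (Icc (0 : ℝ) T))) :
    inner ℝ (stepToLp T f) g = ∫ s in Icc 0 T, (f : ℝ → ℝ) s * g s := by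
  rw [L2.inner_def]
  refine integral_congr_ae ?_
  filter_upwards [(memLp_step f 2).coeFn_toLp] with s hs
  change inner ℝ (((memLp_step f 2).toLp f : Lp ℝ 2 (volume.restrict (Icc (0 : ℝ) T))) s) _ = _
  rw [hs]
  exact mul_comm _ _

theorem norm_stepToLp (f : stepFunctions T) : ‖stepToLp T f‖ = l2Norm f := by
  rw [@norm_eq_sqrt_re_inner ℝ, RCLike.re_to_real, inner_stepToLp, l2Norm]
  congr 1
  refine integral_congr_ae ?_
  filter_upwards [(memLp_step f 2).coeFn_toLp] with s hs
  change _ * ((memLp_step f 2).toLp f : Lp ℝ 2 (volume.restrict (Icc (0 : ℝ) T))) s = _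
  rw [hs, sq]

/-- Rays form a π-system generating the Borel sets; `h0` handles complements. -/
theorem ae_eq_zero_of_forall_setIntegral_Iic {μ : Measure ℝ} [IsFiniteMeasure μ] {g : ℝ → ℝ}
    (hg : Integrable g μ) (h0 : ∫ x, g x ∂μ = 0) (h : ∀ a, ∫ x in Iic a, g x ∂μ = 0) :
    g =ᵐ[μ] 0 := by
  refine ae_eq_zero_of_forall_setIntegral_eq_of_sigmaFinite (fun s _ _ => hg.integrableOn) ?_
  intro s hs _
  induction s, hs using MeasurableSpace.induction_on_inter
    ((BorelSpace.measurable_eq (α := ℝ)).trans (borel_eq_generateFrom_Iic ℝ)) isPiSystem_Iic with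
  | empty => simp
  | basic t ht =>
    obtain ⟨a, rfl⟩ := ht
    exact h a
  | compl t ht ih =>
    have := ih (measure_lt_top _ _)
    have h2 := integral_add_compl ht hg
    linarith
  | iUnion f hd hm ih =>
    rw [integral_iUnion hm hd hg.integrableOn]
    simp [fun i => ih i (measure_lt_top _ _)]

/-- A `g` orthogonal to all indicators of `[0,t]` has zero integral over every ray for Lebesgue
measure on `[0,T]`, hence vanishes. -/
theorem denseRange_stepToLp (hT : 0 ≤ T) : DenseRange (stepToLp T) := by
  have h : (LinearMap.range (stepToLp T)).topologicalClosure = ⊤ := by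
    rw [Submodule.topologicalClosure_eq_top_iff, Submodule.eq_bot_iff]
    intro g hg
    have hgi : IntegrableOn g (Icc 0 T) := (Lp.memLp g).integrable one_le_two
    have key : ∀ t : Icc (0 : ℝ) T, ∫ s in Icc 0 (t : ℝ), g s = 0 := fun t => by
      have h1 := (Submodule.mem_orthogonal _ _).1 hg _ (LinearMap.mem_range_self _
        (intervalStep ⟨0, le_rfl, hT⟩ t t.2.1 _ (Or.inl rfl)))
      rw [inner_stepToLp] at h1
      have h2 : ∀ s, (intervalStep ⟨0, le_rfl, hT⟩ t t.2.1 _ (Or.inl rfl) : ℝ → ℝ) s * g s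
          = (Icc (0 : ℝ) t).indicator g s := fun s => by
        change (Icc (0 : ℝ) t).indicator (fun _ => (1 : ℝ)) s * g s = _
        by_cases hs : s ∈ Icc (0 : ℝ) t <;> simp [hs]
      simp only [h2] at h1
      rwa [setIntegral_indicator measurableSet_Icc,
        inter_eq_right.2 (Icc_subset_Icc_right t.2.2)] at h1
    have hz : g =ᵐ[volume.restrict (Icc (0 : ℝ) T)] 0 := by
      refine ae_eq_zero_of_forall_setIntegral_Iic hgi (key ⟨T, hT, le_rfl⟩) fun a => ?_
      rw [Measure.restrict_restrict measurableSet_Iic]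
      rcases lt_or_ge a 0 with ha | ha
      · have : Iic a ∩ Icc 0 T = ∅ := by ext x; simp; grind
        simp [this]
      · have : Iic a ∩ Icc 0 T = Icc 0 (min a T) := by ext x; simp; grind
        rw [this]
        exact key ⟨min a T, le_min ha hT, min_le_right _ _⟩
    exact Lp.eq_zero_iff_ae_eq_zero.2 hz
  intro g
  have : g ∈ (LinearMap.range (stepToLp T)).topologicalClosure := by rw [h]; trivial
  exact this

end Density

/-! ### The norm `‖·‖_J` and the domain of the Wiener integral -/

section Domain

variable {Ω : Type*} [MeasurableSpace Ω] {P : Measure Ω} {T : ℝ} {X : Icc (0 : ℝ) T → Ω → ℝ}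

theorem equivU_symm_kernelCM (hX : ∀ t, MemLp (X t) 2 P) (t : Icc (0 : ℝ) T) :
    (equivU hX).symm (kernelCM hX t) = evalH hX t := by
  rw [LinearEquiv.symm_apply_eq]
  exact Subtype.ext (mapU_evalH hX t).symm

/-- The inner product of `K_X` is transported from `H` by `U`, and `U⁻¹` sends `Γ^X(t,·)` to `X_t`.
From here on the Cameron–Martin space is replaced by `L²(P)`. -/
theorem normJ_eq (hX : ∀ t, MemLp (X t) 2 P) {x : ℝ → Lp ℝ 2 P}
    (hx : ∀ t : Icc (0 : ℝ) T, (hX t).toLp (X t) = x t) (f : stepFunctions T) :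
    normJ hX f = ‖jumpSum x f‖ := by
  have h : (((equivU hX).symm (mapJ hX f) : gaussianHilbertSpace hX) : Lp ℝ 2 P)
      = jumpSum x f := by
    simp only [mapJ, jumpSum, LinearMap.comp_apply, Finsupp.linearCombination_apply, Finsupp.sum,
      map_sum, map_smul, equivU_symm_kernelCM, Submodule.coe_sum, Submodule.coe_smul]
    exact Finset.sum_congr rfl fun t _ => by rw [← hx t]; rfl
  rw [normJ, innerJ, cmInner_eq_inner, ← h]
  exact (norm_eq_sqrt_real_inner ((equivU hX).symm (mapJ hX f))).symm

/-- `toWienerDomain` as a linear map. -/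
noncomputable def toWienerDomainLinear (hX : ∀ t, MemLp (X t) 2 P) :
    stepFunctions T →ₗ[ℝ] WienerDomain hX where
  toFun := toWienerDomain hX
  map_add' f g := UniformSpace.Completion.coe_add
    (SeparationQuotient.mk (show StepJ hX from f)) (SeparationQuotient.mk (show StepJ hX from g))
  map_smul' c f := UniformSpace.Completion.coe_smul c
    (SeparationQuotient.mk (show StepJ hX from f))

theorem norm_toWienerDomain (hX : ∀ t, MemLp (X t) 2 P) (f : stepFunctions T) :
    ‖toWienerDomain hX f‖ = normJ hX f :=
  (UniformSpace.Completion.norm_coe _).trans (SeparationQuotient.norm_mk _)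

theorem denseRange_toWienerDomain (hX : ∀ t, MemLp (X t) 2 P) :
    DenseRange (toWienerDomain hX) :=
  (UniformSpace.Completion.denseRange_coe (α := QuotientJ hX)).comp
    (SeparationQuotient.surjective_mk (X := StepJ hX)).denseRange
    (UniformSpace.Completion.continuous_coe _)

theorem exists_wienerDomain_equiv (hX : ∀ t, MemLp (X t) 2 P) (hT : 0 ≤ T) {c C : ℝ} (hc : 0 < c)
    (h : ∀ f : stepFunctions T, c * l2Norm f ≤ normJ hX f ∧ normJ hX f ≤ C * l2Norm f) :
    ∃ Φ : WienerDomain hX ≃L[ℝ] Lp ℝ 2 (volume.restrict (Icc (0 : ℝ) T)),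
      ∀ f : stepFunctions T,
        Φ (toWienerDomain hX f) =ᵐ[volume.restrict (Icc (0 : ℝ) T)] (f : ℝ → ℝ) := by
  have h1 : ∃ C, ∀ f, ‖stepToLp T (LinearEquiv.refl ℝ (stepFunctions T) f)‖
      ≤ C * ‖toWienerDomainLinear hX f‖ := ⟨c⁻¹, fun f => by
    change ‖stepToLp T f‖ ≤ c⁻¹ * ‖toWienerDomain hX f‖
    rw [norm_toWienerDomain, norm_stepToLp, le_inv_mul_iff₀ hc]
    exact (h f).1⟩
  have h2 : ∃ C, ∀ f, ‖toWienerDomainLinear hX ((LinearEquiv.refl ℝ (stepFunctions T)).symm f)‖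
      ≤ C * ‖stepToLp T f‖ := ⟨C, fun f => by
    change ‖toWienerDomain hX f‖ ≤ _
    rw [norm_toWienerDomain, norm_stepToLp]
    exact (h f).2⟩
  -- The identity on step functions is bounded in both directions between two norms with dense
  -- images, so it extends to the completions.
  refine ⟨(LinearEquiv.refl ℝ (stepFunctions T)).extend (toWienerDomainLinear hX) (stepToLp T)
    (denseRange_toWienerDomain hX) h1 (denseRange_stepToLp hT) h2, fun f => ?_⟩
  have e := LinearEquiv.extend_eq (LinearEquiv.refl ℝ (stepFunctions T))
    (toWienerDomainLinear hX) (stepToLp T) (denseRange_toWienerDomain hX) h1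
    (denseRange_stepToLp hT) h2 f
  exact (Lp.ext_iff.1 e).trans (memLp_step f 2).coeFn_toLp

end Domain

/-! ### The Ornstein–Uhlenbeck process as a curve in `L²(P)` -/

section OUCurve

variable {Ω : Type*} [MeasurableSpace Ω] {P : Measure Ω}

theorem memLp_brownian {W : ℝ≥0 → Ω → ℝ} (hW : IsBrownianReal W P) (t : ℝ≥0) :
    MemLp (W t) 2 P := (hW.isGaussianProcess.hasGaussianLaw_eval t).memLp_two

/-- Brownian motion as a curve in `L²(P)`. -/
noncomputable def brownianCurve {W : ℝ≥0 → Ω → ℝ} (hW : IsBrownianReal W P) (t : ℝ) : Lp ℝ 2 P :=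
  (memLp_brownian hW t.toNNReal).toLp (W t.toNNReal)

theorem inner_toLp {f g : Ω → ℝ} (hf : MemLp f 2 P) (hg : MemLp g 2 P) :
    inner ℝ (hf.toLp f) (hg.toLp g) = ∫ ω, f ω * g ω ∂P := by
  rw [L2.inner_def]
  refine integral_congr_ae ?_
  filter_upwards [hf.coeFn_toLp, hg.coeFn_toLp] with ω h1 h2
  rw [h1, h2]
  exact mul_comm _ _

theorem coeFn_add_smul {f g : Ω → ℝ} {u v : Lp ℝ 2 P} (hf : u =ᵐ[P] f) (hg : v =ᵐ[P] g) (c : ℝ) :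
    ⇑(u + c • v) =ᵐ[P] fun ω => f ω + c * g ω := by
  filter_upwards [Lp.coeFn_add u (c • v), Lp.coeFn_smul c v, hf, hg] with ω h1 h2 h3 h4
  rw [h1, Pi.add_apply, h2, Pi.smul_apply, h3, h4, smul_eq_mul]

/-- A version of `volterra θ y` in `L²(P)` is obtained by solving the equation pathwise. -/
theorem coeFn_volterra {θ t : ℝ} (ht : 0 ≤ t) {y : ℝ → Lp ℝ 2 P} (hy : Continuous y)
    {Y : ℝ → Ω → ℝ} (hY : ∀ s, y s =ᵐ[P] Y s) (hYc : ∀ᵐ ω ∂P, Continuous fun s => Y s ω) :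
    ⇑(volterra θ y t) =ᵐ[P] fun ω => volterra θ (fun s => Y s ω) t := by
  have h1 : ∀ s, ⇑(Real.exp (θ * s) • y s) =ᵐ[P] fun ω => Real.exp (θ * s) • Y s ω := fun s => by
    filter_upwards [Lp.coeFn_smul (Real.exp (θ * s)) (y s), hY s] with ω h1 h2
    rw [h1, Pi.smul_apply, h2]
  have h2 := coeFn_intervalIntegral ht (continuous_exp_smul θ hy) h1
    (hYc.mono fun ω h => continuous_exp_smul θ h)
  filter_upwards [coeFn_add_smul (hY t) h2 (-(θ * Real.exp (-(θ * t))))] with ω h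
  rw [volterra, sub_eq_add_neg, ← neg_smul, h, volterra, smul_eq_mul]
  ring

variable {T θ σ : ℝ} {σ₀ : ℝ≥0} {W : ℝ≥0 → Ω → ℝ} {X : Icc (0 : ℝ) T → Ω → ℝ}

theorem IsCenteredOU.memLp_init {hT : 0 ≤ T} (h : IsCenteredOU P hT θ σ σ₀ W X) :
    MemLp (X ⟨0, le_rfl, hT⟩) 2 P := h.law_init.hasGaussianLaw.memLp_two

/-- Independence factors the expectation, and `W_t` has mean zero. -/
theorem IsCenteredOU.inner_init {hT : 0 ≤ T} (h : IsCenteredOU P hT θ σ σ₀ W X) (t : ℝ) :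
    inner ℝ (h.memLp_init.toLp _) (brownianCurve h.brownian t) = 0 := by
  have hi : IndepFun (X ⟨0, le_rfl, hT⟩) (W t.toNNReal) P :=
    h.indep_init.comp measurable_id (measurable_pi_apply t.toNNReal)
  have he := hi.integral_mul_eq_mul_integral h.memLp_init.aestronglyMeasurable
    (memLp_brownian h.brownian _).aestronglyMeasurable
  rw [h.brownian.integral_eval, mul_zero] at he
  rw [brownianCurve, inner_toLp]
  exact he

variable [IsProbabilityMeasure P]

theorem inner_brownianCurve {W : ℝ≥0 → Ω → ℝ} (hW : IsBrownianReal W P) (s t : ℝ) :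
    inner ℝ (brownianCurve hW s) (brownianCurve hW t) = min s.toNNReal t.toNNReal := by
  have h := hW.covariance_eval s.toNNReal t.toNNReal
  rw [covariance_eq_sub (memLp_brownian hW _) (memLp_brownian hW _), hW.integral_eval, zero_mul,
    sub_zero] at h
  rw [brownianCurve, brownianCurve, inner_toLp, ← h]
  rfl

/-- Mean-square continuity is read off the covariance, by expanding `‖w(s) - w(t)‖²`. -/
theorem isBrownianCurve_brownianCurve {W : ℝ≥0 → Ω → ℝ} (hW : IsBrownianReal W P) :
    IsBrownianCurve (brownianCurve hW) where
  continuous := by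
    rw [continuous_iff_continuousAt]
    intro t
    rw [ContinuousAt, tendsto_iff_norm_sub_tendsto_zero]
    have h : ∀ s, ‖brownianCurve hW s - brownianCurve hW t‖
        = √((s.toNNReal : ℝ) - 2 * min (s.toNNReal : ℝ) t.toNNReal + t.toNNReal) := fun s => by
      rw [← Real.sqrt_sq (norm_nonneg _), norm_sub_sq_real, ← real_inner_self_eq_norm_sq,
        ← real_inner_self_eq_norm_sq, inner_brownianCurve, inner_brownianCurve,
        inner_brownianCurve]
      simp
    simp only [h]
    have hc : Continuous fun s : ℝ =>
        √((s.toNNReal : ℝ) - 2 * min (s.toNNReal : ℝ) t.toNNReal + t.toNNReal) := by fun_prop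
    convert hc.tendsto t using 2
    rw [min_self, show (t.toNNReal : ℝ) - 2 * t.toNNReal + t.toNNReal = 0 by ring, Real.sqrt_zero]
  inner_eq s t hs ht := by
    rw [inner_brownianCurve, NNReal.coe_min, Real.coe_toNNReal s hs, Real.coe_toNNReal t ht]

/-- Almost every path, extended continuously off `[0,T]`, solves the Volterra equation with forcing
`X_0 + σW`; by uniqueness it is the pathwise solution, a version of the `L²(P)` solution. -/
theorem IsCenteredOU.coeFn_ouCurve {hT : 0 ≤ T} (h : IsCenteredOU P hT θ σ σ₀ W X)
    (t : Icc (0 : ℝ) T) :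
    ⇑(ouCurve θ σ (h.memLp_init.toLp _) (brownianCurve h.brownian) t) =ᵐ[P] X t := by
  have hw := (isBrownianCurve_brownianCurve h.brownian).continuous
  have hY : ∀ s, ⇑(h.memLp_init.toLp _ + σ • brownianCurve h.brownian s)
      =ᵐ[P] fun ω => X ⟨0, le_rfl, hT⟩ ω + σ * W s.toNNReal ω := fun s =>
    coeFn_add_smul h.memLp_init.coeFn_toLp (memLp_brownian h.brownian _).coeFn_toLp σ
  have hYc : ∀ᵐ ω ∂P, Continuous fun s : ℝ =>
      X ⟨0, le_rfl, hT⟩ ω + σ * W s.toNNReal ω := by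
    filter_upwards [h.brownian.cont] with ω hω
    have : Continuous fun s : ℝ => W s.toNNReal ω := hω.comp continuous_real_toNNReal
    fun_prop
  filter_upwards [coeFn_volterra (θ := θ) t.2.1 (y := fun s => h.memLp_init.toLp _
    + σ • brownianCurve h.brownian s) (by fun_prop) hY hYc, h.continuous_paths, h.sde]
    with ω h1 h2 h3
  refine Eq.trans h1 (Eq.symm ?_)
  have hx : Continuous (IccExtend hT fun r => X r ω) := h2.Icc_extend'
  refine (IccExtend_of_mem hT (fun r => X r ω) t.2).symm.trans
    (eq_volterra (T := T) hx (fun s hs => ?_) t.2)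
  rw [IccExtend_of_mem hT (fun r => X r ω) hs, h3 ⟨s, hs⟩, smul_eq_mul,
    show (⟨s, hs.1⟩ : ℝ≥0) = s.toNNReal from (Real.toNNReal_of_nonneg hs.1).symm]
  ring

/-- Square integrability needs no moment estimate: `X_t` agrees almost surely with an element of
`L²(P)`. -/
theorem IsCenteredOU.memLp {hT : 0 ≤ T} (h : IsCenteredOU P hT θ σ σ₀ W X)
    (t : Icc (0 : ℝ) T) : MemLp (X t) 2 P :=
  (memLp_congr_ae (h.coeFn_ouCurve t)).1 (Lp.memLp _)

theorem IsCenteredOU.toLp_eq {hT : 0 ≤ T} (h : IsCenteredOU P hT θ σ σ₀ W X)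
    (t : Icc (0 : ℝ) T) : (h.memLp t).toLp (X t)
      = ouCurve θ σ (h.memLp_init.toLp _) (brownianCurve h.brownian) t :=
  Lp.ext ((h.memLp t).coeFn_toLp.trans (h.coeFn_ouCurve t).symm)

end OUCurve

end WienerOU

theorem mainTheorem9 {Ω : Type*} [MeasurableSpace Ω] (P : Measure Ω) [IsProbabilityMeasure P]
    (T θ σ : ℝ) (σ₀ : ℝ≥0) (hT : 0 < T) (hθ : 0 < θ) (hσ : 0 < σ) (hθT : θ * T ≤ 4 / 3)
    (W : ℝ≥0 → Ω → ℝ) (X : Set.Icc (0 : ℝ) T → Ω → ℝ)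
    (hOU : WienerOU.IsCenteredOU P hT.le θ σ σ₀ W X) :
    ∃ hX : ∀ t, MemLp (X t) 2 P,
      (∃ c C : ℝ, 0 < c ∧ 0 < C ∧ ∀ f : WienerOU.stepFunctions T,
        c * WienerOU.l2Norm f ≤ WienerOU.normJ hX f ∧
        WienerOU.normJ hX f ≤ C * WienerOU.l2Norm f) ∧
      ∃ Φ : WienerOU.WienerDomain hX ≃L[ℝ] Lp ℝ 2 (volume.restrict (Set.Icc (0 : ℝ) T)),
        ∀ f : WienerOU.stepFunctions T,
          Φ (WienerOU.toWienerDomain hX f) =ᵐ[volume.restrict (Set.Icc (0 : ℝ) T)]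
            (f : ℝ → ℝ) := by
  have hw := WienerOU.isBrownianCurve_brownianCurve hOU.brownian
  obtain ⟨c, hc, hlow⟩ := WienerOU.exists_le_norm_jumpSum_ouCurve (θ := θ) hw hT hσ
    fun t _ => hOU.inner_init t
  obtain ⟨C, hC, hup⟩ := WienerOU.exists_norm_jumpSum_ouCurve_le (θ := θ) (σ := σ)
    (x₀ := hOU.memLp_init.toLp _) hw hT
  have h : ∀ f : WienerOU.stepFunctions T,
      c * WienerOU.l2Norm f ≤ WienerOU.normJ hOU.memLp f ∧
      WienerOU.normJ hOU.memLp f ≤ C * WienerOU.l2Norm f := fun f => by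
    rw [WienerOU.normJ_eq hOU.memLp hOU.toLp_eq]
    exact ⟨hlow f, hup f⟩
  exact ⟨hOU.memLp, ⟨c, C, hc, hC, h⟩, WienerOU.exists_wienerDomain_equiv hOU.memLp hT.le hc h⟩
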